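/- Let $m_1,m_2\ge 3$ be integers, $\alpha\in\{0,\dots,m_1-1\}$, $\beta\in\{0,\dots,m_2-1\}$, $q,s\in(0,1)$ and $\delta\in\{-1,1\}$. For $\rho\in[-1,1]$, let $(X_1,X_2)$ have the bivariate wrapped geometric (BWG) distribution on the grid $\{2\pi k/m_1:0\le k<m_1\}\times\{2\pi l/m_2:0\le l<m_2\}$, that is, $$P\Big(X_1=\tfrac{2\pi k}{m_1},X_2=\tfrac{2\pi l}{m_2}\Big)=C\,\big(q^{\zeta_1}+q^{m_1-\zeta_1}\big)\big(s^{\zeta_2}+s^{m_2-\zeta_2}\big)\Big(1+\rho\cos\Big(\tfrac{2\pi\zeta_1}{m_1}-\delta\,\tfrac{2\pi\zeta_2}{m_2}\Big)\Big),$$ where $\zeta_1=(k-\alpha)\bmod m_1$, $\zeta_2=(l-\beta)\bmod m_2$ and $C=C(\rho)$ is the normalizing constant. Let $\Sigma_{ij}$ be the $2\times 2$ covariance matrix between $(\cos X_i,\sin X_i)$ and $(\cos X_j,\sin X_j)$, for $i,j\in\{1,2\}$, and let $$\rho_1^2=\operatorname{tr}\big(\Sigma_{11}^{-1}\Sigma_{12}\Sigma_{22}^{-1}\Sigma_{21}\big)$$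 be the Jupp–Mardia circular correlation coefficient of $(X_1,X_2)$. Then, for every $\rho\in[-1,1]$, the above is a probability distribution and $\Sigma_{11}$ and $\Sigma_{22}$ are invertible, so that $\rho_1^2$ is well defined; and, with $m_1,m_2,\alpha,\beta,q,s,\delta$ fixed, $\rho_1^2$ is strictly increasing in $\rho$ on $(0,1]$ and strictly decreasing in $\rho$ on $[-1,0)$. -/

import Mathlib

open MeasureTheory ProbabilityTheory

noncomputable section

/-- The residue `(k - α) mod m`, as a representative in `{0, …, m - 1}`
(subtraction in `Fin m` is subtraction modulo `m`). -/
def bwgResidue {m : ℕ} (α k : Fin m) : ℕ := (k - α).val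

/-- The unnormalised mass of the bivariate wrapped geometric distribution at the grid point
`(2πk/m₁, 2πl/m₂)`. -/
def bwgWeight {m₁ m₂ : ℕ} (α : Fin m₁) (β : Fin m₂) (q s δ ρ : ℝ) (k : Fin m₁) (l : Fin m₂) :
    ℝ :=
  (q ^ bwgResidue α k + q ^ (m₁ - bwgResidue α k)) *
    (s ^ bwgResidue β l + s ^ (m₂ - bwgResidue β l)) *
    (1 + ρ * Real.cos (2 * Real.pi * (bwgResidue α k : ℝ) / (m₁ : ℝ)
      - δ * (2 * Real.pi * (bwgResidue β l : ℝ) / (m₂ : ℝ))))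

/-- The probability mass function of the bivariate wrapped geometric distribution: the weights,
divided by their total. -/
def bwgPmf {m₁ m₂ : ℕ} (α : Fin m₁) (β : Fin m₂) (q s δ ρ : ℝ) (k : Fin m₁) (l : Fin m₂) : ℝ :=
  bwgWeight α β q s δ ρ k l /
    ∑ i : Fin m₁, ∑ j : Fin m₂, bwgWeight α β q s δ ρ i j

/-- The bivariate wrapped geometric distribution, as the law of `(X₁, X₂)` on pairs of angles; it
is carried by the grid `{2πk/m₁} × {2πl/m₂}`. -/
def bwg {m₁ m₂ : ℕ} (α : Fin m₁) (β : Fin m₂) (q s δ ρ : ℝ) : Measure (ℝ × ℝ) :=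
  ∑ k : Fin m₁, ∑ l : Fin m₂,
    ENNReal.ofReal (bwgPmf α β q s δ ρ k l) •
      Measure.dirac (2 * Real.pi * ((k : ℕ) : ℝ) / (m₁ : ℝ),
        2 * Real.pi * ((l : ℕ) : ℝ) / (m₂ : ℝ))

/-- The embedding of an angle in the plane. -/
def circleEmbed (x : ℝ) : Fin 2 → ℝ := ![Real.cos x, Real.sin x]

/-- The (cross-)covariance matrix of the embedded angles `X` and `Y` under `μ`. -/
def angleCov (μ : Measure (ℝ × ℝ)) (X Y : ℝ × ℝ → ℝ) : Matrix (Fin 2) (Fin 2) ℝ :=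
  Matrix.of fun a b => cov[fun ω => circleEmbed (X ω) a, fun ω => circleEmbed (Y ω) b; μ]

/-- The Jupp–Mardia circular correlation coefficient
`ρ₁² = tr(Σ₁₁⁻¹ Σ₁₂ Σ₂₂⁻¹ Σ₂₁)` of a bivariate circular law `μ`. -/
def juppMardia (μ : Measure (ℝ × ℝ)) : ℝ :=
  Matrix.trace ((angleCov μ Prod.fst Prod.fst)⁻¹ * angleCov μ Prod.fst Prod.snd *
    (angleCov μ Prod.snd Prod.snd)⁻¹ * angleCov μ Prod.snd Prod.fst)

end

/-! Shifting each angle by its mode rotates its embedding in the plane, which leaves the trace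
unchanged (`juppMardia_eq_of_shift`). The recentred weights are even, so odd moments vanish and
every covariance matrix is diagonal. The coefficient is then a cosine term plus a sine term, each a
constant times `ρ ^ 2 / (f₁ f₂)`, where the `fᵢ` come from the tilted marginals (`juppMardia_bwg`).

It remains to see that `ρ / fᵢ` increases on `(0, 1]`. For sine, `fᵢ` is affine with positive value
at `0`. For cosine it is the quadratic `V + t (μ₃ - μ₁ μ₂) + t² c` with `V = μ₂ - μ₁²` and `c = μ₁
μ₃ - μ₂²`, where `μₙ` are the cosine moments; the linear term drops out of the comparison, and `c ≤
V` suffices (`wgMoment_mul_sub_sq_le`). Negative `ρ` reduces to positive `ρ` by changing the signs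
of `ρ` and both first moments. -/

noncomputable section

/-- The mean of `F` under the wrapped geometric law on `{2πi/m}` with mode `0`. -/
def wgMean (m : ℕ) (q : ℝ) (F : ℝ → ℝ) : ℝ :=
  (∑ i : Fin m, (q ^ (i : ℕ) + q ^ (m - (i : ℕ))) * F (2 * Real.pi * (i : ℕ) / m)) /
    ∑ i : Fin m, (q ^ (i : ℕ) + q ^ (m - (i : ℕ)))

/-- The `n`-th moment of the cosine of a wrapped geometric angle with mode `0`. -/
def wgMoment (m : ℕ) (q : ℝ) (n : ℕ) : ℝ := wgMean m q fun x => Real.cos x ^ n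

/-- The unnormalised second moment of `sin` under the tilted weight `1 + t cos`. -/
def wgSinTilt (m : ℕ) (q t : ℝ) : ℝ :=
  (1 - wgMoment m q 2) + t * (wgMoment m q 1 - wgMoment m q 3)

/-- The unnormalised variance of `cos` under the tilted weight `1 + t cos`. -/
def wgCosTilt (m : ℕ) (q t : ℝ) : ℝ :=
  (wgMoment m q 2 + t * wgMoment m q 3) * (1 + t * wgMoment m q 1) -
    (wgMoment m q 1 + t * wgMoment m q 2) ^ 2

/-- The Jupp–Mardia coefficient of the bivariate wrapped geometric law, in closed form, with the
tilts of the two marginals given by `ρ * b` and `ρ * a`. -/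
def bwgCorr (m₁ m₂ : ℕ) (q s a b ρ : ℝ) : ℝ :=
  (wgCosTilt m₁ q 0 * wgCosTilt m₂ s 0) ^ 2 *
      (ρ ^ 2 / (wgCosTilt m₁ q (ρ * b) * wgCosTilt m₂ s (ρ * a))) +
    (wgSinTilt m₁ q 0 * wgSinTilt m₂ s 0) ^ 2 *
      (ρ ^ 2 / (wgSinTilt m₁ q (ρ * b) * wgSinTilt m₂ s (ρ * a)))

end

/-! ### Moments of one wrapped geometric angle: parity, positivity, and the key moment inequality.
-/

section WrappedGeometric

variable {m : ℕ} {q : ℝ}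

lemma wgWeight_pos (hq : 0 < q) (i : Fin m) : 0 < q ^ (i : ℕ) + q ^ (m - (i : ℕ)) := by
  positivity

lemma wgTotal_pos (hm : 3 ≤ m) (hq : 0 < q) :
    0 < ∑ i : Fin m, (q ^ (i : ℕ) + q ^ (m - (i : ℕ))) :=
  Finset.sum_pos (fun i _ => wgWeight_pos hq i) ⟨⟨0, by omega⟩, Finset.mem_univ _⟩

lemma wgMean_nonneg (hq : 0 < q) {F : ℝ → ℝ} (hF : ∀ x, 0 ≤ F x) : 0 ≤ wgMean m q F :=
  div_nonneg (Finset.sum_nonneg fun i _ => mul_nonneg (wgWeight_pos hq i).le (hF _))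
    (Finset.sum_nonneg fun i _ => (wgWeight_pos hq i).le)

lemma wgMean_pos (hm : 3 ≤ m) (hq : 0 < q) {F : ℝ → ℝ} (hF : ∀ x, 0 ≤ F x) (i : Fin m)
    (hi : 0 < F (2 * Real.pi * (i : ℕ) / m)) : 0 < wgMean m q F :=
  div_pos (Finset.sum_pos' (fun i _ => mul_nonneg (wgWeight_pos hq i).le (hF _))
    ⟨i, Finset.mem_univ _, mul_pos (wgWeight_pos hq i) hi⟩) (wgTotal_pos hm hq)

/-- Every even function needed below is a cubic in `cos`, once `sin²` is replaced by `1 - cos²`, so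
three moments determine all the means. -/
lemma wgMean_cubic (hm : 3 ≤ m) (hq : 0 < q) {F : ℝ → ℝ} (c₀ c₁ c₂ c₃ : ℝ)
    (hF : ∀ x, F x = c₀ + c₁ * Real.cos x + c₂ * Real.cos x ^ 2 + c₃ * Real.cos x ^ 3) :
    wgMean m q F = c₀ + c₁ * wgMoment m q 1 + c₂ * wgMoment m q 2 + c₃ * wgMoment m q 3 := by
  have h := (wgTotal_pos hm hq).ne'
  simp only [wgMoment, wgMean]
  field_simp
  simp only [Finset.mul_sum, Finset.sum_mul, ← Finset.sum_add_distrib, hF]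
  exact Finset.sum_congr rfl fun i _ => by ring

/-- The reflection `i ↦ -i` of the grid swaps the two powers in the weight and negates `F`, so the
sum equals its own negative. -/
lemma wgMean_eq_zero_of_odd (hm : 3 ≤ m) {F : ℝ → ℝ} (hF : F.Periodic (2 * Real.pi))
    (hodd : F.Odd) : wgMean m q F = 0 := by
  have : NeZero m := ⟨by omega⟩
  have hm' : (m : ℝ) ≠ 0 := by exact_mod_cast (by omega : m ≠ 0)
  have h0 : F 0 = 0 := by have := hodd 0; simp at this; linarith
  have key : ∑ i : Fin m, (q ^ (i : ℕ) + q ^ (m - (i : ℕ))) * F (2 * Real.pi * (i : ℕ) / m) =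
      -∑ i : Fin m, (q ^ (i : ℕ) + q ^ (m - (i : ℕ))) * F (2 * Real.pi * (i : ℕ) / m) := by
    rw [← Finset.sum_neg_distrib]
    refine Fintype.sum_equiv (Equiv.neg (Fin m)) _ _ fun i => ?_
    rcases eq_or_ne i 0 with rfl | hi
    -- At `i = 0` the value of `-i` is `0`, not `m`; here `F 0 = 0` is what is needed.
    · simp [h0]
    · have hv : ((-i : Fin m) : ℕ) = m - i := by
        rw [Fin.val_neg, if_neg hi]
      have hle : (i : ℕ) ≤ m := i.2.le
      rw [Equiv.neg_apply, hv, Nat.sub_sub_self hle, Nat.cast_sub hle]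
      have : 2 * Real.pi * ((m : ℝ) - (i : ℕ)) / m = 2 * Real.pi - 2 * Real.pi * (i : ℕ) / m := by
        field_simp
      rw [this, hF.sub_eq', hodd]
      ring
  rw [wgMean, show ∑ i : Fin m, (q ^ (i : ℕ) + q ^ (m - (i : ℕ))) *
    F (2 * Real.pi * (i : ℕ) / m) = 0 by linarith, zero_div]

lemma sin_grid_one_pos (hm : 3 ≤ m) : 0 < Real.sin (2 * Real.pi * (1 : ℕ) / m) := by
  have hm' : (3 : ℝ) ≤ m := by exact_mod_cast hm
  have hpi := Real.pi_pos
  apply Real.sin_pos_of_pos_of_lt_pi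
  · positivity
  · rw [div_lt_iff₀ (by linarith)]
    push_cast
    nlinarith

lemma cos_grid_one_lt_one (hm : 3 ≤ m) : Real.cos (2 * Real.pi * (1 : ℕ) / m) < 1 := by
  have h := sin_grid_one_pos hm
  have := Real.sin_sq_add_cos_sq (2 * Real.pi * (1 : ℕ) / m)
  nlinarith

lemma neg_one_lt_cos_grid_one (hm : 3 ≤ m) : -1 < Real.cos (2 * Real.pi * (1 : ℕ) / m) := by
  have h := sin_grid_one_pos hm
  have := Real.sin_sq_add_cos_sq (2 * Real.pi * (1 : ℕ) / m)
  nlinarith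

lemma wgMoment_one_lt_one (hm : 3 ≤ m) (hq : 0 < q) : wgMoment m q 1 < 1 := by
  have h := wgMean_pos hm hq (F := fun x => 1 - Real.cos x)
    (fun x => by linarith [Real.cos_le_one x]) ⟨1, by omega⟩
    (by simpa using cos_grid_one_lt_one hm)
  rw [wgMean_cubic hm hq 1 (-1) 0 0 fun x => by ring] at h
  linarith

lemma neg_one_lt_wgMoment_one (hm : 3 ≤ m) (hq : 0 < q) : -1 < wgMoment m q 1 := by
  have h := wgMean_pos hm hq (F := fun x => 1 + Real.cos x)
    (fun x => by linarith [Real.neg_one_le_cos x]) ⟨1, by omega⟩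
    (by have := neg_one_lt_cos_grid_one hm; dsimp only; linarith)
  rw [wgMean_cubic hm hq 1 1 0 0 fun x => by ring] at h
  linarith

lemma one_add_mul_cos_pos {t : ℝ} (ht : |t| < 1) (x : ℝ) : 0 < 1 + t * Real.cos x := by
  have h : |t * Real.cos x| < 1 := by
    rw [abs_mul]
    nlinarith [Real.abs_cos_le_one x, abs_nonneg t, abs_nonneg (Real.cos x)]
  linarith [(abs_lt.1 h).1]

lemma wgSinTilt_pos (hm : 3 ≤ m) (hq : 0 < q) {t : ℝ} (ht : |t| < 1) :
    0 < wgSinTilt m q t := by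
  rw [wgSinTilt]
  have h := wgMean_pos hm hq (F := fun x => Real.sin x ^ 2 * (1 + t * Real.cos x))
    (fun x => mul_nonneg (sq_nonneg _) (one_add_mul_cos_pos ht x).le) ⟨1, by omega⟩
    (mul_pos (pow_pos (sin_grid_one_pos hm) 2) (one_add_mul_cos_pos ht _))
  rw [wgMean_cubic hm hq 1 t (-1) (-t) fun x => by rw [Real.sin_sq]; ring] at h
  linarith

/-- A variance of `cos` under a positive weight, scaled by the squared total mass. It is nonzero
because `cos` differs at the grid points `0` and `1`. -/
lemma wgCosTilt_pos (hm : 3 ≤ m) (hq : 0 < q) {t : ℝ} (ht : |t| < 1) :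
    0 < wgCosTilt m q t := by
  rw [wgCosTilt]
  have hN : 0 < 1 + t * wgMoment m q 1 := by
    have := wgMean_pos hm hq (F := fun x => 1 + t * Real.cos x)
      (fun x => (one_add_mul_cos_pos ht x).le) ⟨0, by omega⟩ (one_add_mul_cos_pos ht _)
    rw [wgMean_cubic hm hq 1 t 0 0 fun x => by ring] at this
    linarith
  have key : ∀ c : ℝ, 0 < (wgMoment m q 2 + t * wgMoment m q 3) -
      2 * c * (wgMoment m q 1 + t * wgMoment m q 2) + c ^ 2 * (1 + t * wgMoment m q 1) := by
    intro c
    have hF : ∀ x, 0 ≤ (1 + t * Real.cos x) * (Real.cos x - c) ^ 2 := fun x =>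
      mul_nonneg (one_add_mul_cos_pos ht x).le (sq_nonneg _)
    have h : 0 < wgMean m q fun x => (1 + t * Real.cos x) * (Real.cos x - c) ^ 2 := by
      rcases eq_or_ne c 1 with rfl | hc
      · refine wgMean_pos hm hq hF ⟨1, by omega⟩ (mul_pos (one_add_mul_cos_pos ht _) ?_)
        exact sq_pos_of_ne_zero (sub_ne_zero.2 (cos_grid_one_lt_one hm).ne)
      · refine wgMean_pos hm hq hF ⟨0, by omega⟩ (mul_pos (one_add_mul_cos_pos ht _) ?_)
        have : 1 - c ≠ 0 := sub_ne_zero.2 hc.symm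
        simp only [Nat.cast_zero, mul_zero, zero_div, Real.cos_zero]
        positivity
    rw [wgMean_cubic hm hq (c ^ 2) (t * c ^ 2 - 2 * c) (1 - 2 * c * t) t fun x => by ring] at h
    linarith
  -- This `c` is the tilted mean, which minimises the quadratic in `key`.
  have h := key ((wgMoment m q 1 + t * wgMoment m q 2) / (1 + t * wgMoment m q 1))
  have := mul_pos h hN
  field_simp at this
  nlinarith

/-- `E[(1 - XY)(X - Y)²] ≥ 0` for independent cosines `X`, `Y`. -/
lemma wgMoment_mul_sub_sq_le (hm : 3 ≤ m) (hq : 0 < q) :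
    wgMoment m q 1 * wgMoment m q 3 - wgMoment m q 2 ^ 2 ≤
      wgMoment m q 2 - wgMoment m q 1 ^ 2 := by
  -- Average over `X` with `Y = cos y` fixed; the result is a cubic in `cos y`, averaged next.
  have inner : ∀ y : ℝ, 0 ≤ wgMoment m q 2 + (-2 * wgMoment m q 1 - wgMoment m q 3) * Real.cos y
      + (1 + 2 * wgMoment m q 2) * Real.cos y ^ 2 - wgMoment m q 1 * Real.cos y ^ 3 := by
    intro y
    have h := wgMean_nonneg (m := m) hq
      (F := fun x => (1 - Real.cos x * Real.cos y) * (Real.cos x - Real.cos y) ^ 2) fun x => by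
        refine mul_nonneg ?_ (sq_nonneg _)
        have : |Real.cos x * Real.cos y| ≤ 1 := by
          rw [abs_mul]
          exact mul_le_one₀ (Real.abs_cos_le_one x) (abs_nonneg _) (Real.abs_cos_le_one y)
        linarith [(abs_le.1 this).2]
    rw [wgMean_cubic hm hq (Real.cos y ^ 2) (-2 * Real.cos y - Real.cos y ^ 3)
      (1 + 2 * Real.cos y ^ 2) (-Real.cos y) fun x => by ring] at h
    linarith
  have h := wgMean_nonneg (m := m) hq inner
  rw [wgMean_cubic hm hq (wgMoment m q 2) (-2 * wgMoment m q 1 - wgMoment m q 3)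
    (1 + 2 * wgMoment m q 2) (-wgMoment m q 1) fun x => by ring] at h
  linarith

end WrappedGeometric

/-! ### Monotonicity of the closed form in `ρ`. -/

section Monotonicity

lemma sq_div_mul_le_sq_div_mul {x y f₁ f₂ g₁ g₂ : ℝ} (hx : 0 < x) (hf₁ : 0 < f₁)
    (hg₁ : 0 < g₁) (hf₂ : 0 < f₂) (hg₂ : 0 < g₂) (h₁ : g₁ * x ≤ f₁ * y) (h₂ : g₂ * x ≤ f₂ * y) :
    x ^ 2 / (f₁ * f₂) ≤ y ^ 2 / (g₁ * g₂) := by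
  rw [div_le_div_iff₀ (by positivity) (by positivity)]
  calc x ^ 2 * (g₁ * g₂) = (g₁ * x) * (g₂ * x) := by ring
    _ ≤ (f₁ * y) * (f₂ * y) := mul_le_mul h₁ h₂ (by positivity) (le_trans (by positivity) h₁)
    _ = y ^ 2 * (f₁ * f₂) := by ring

lemma sq_div_mul_lt_sq_div_mul {x y f₁ f₂ g₁ g₂ : ℝ} (hx : 0 < x) (hf₁ : 0 < f₁)
    (hg₁ : 0 < g₁) (hf₂ : 0 < f₂) (hg₂ : 0 < g₂) (h₁ : g₁ * x < f₁ * y) (h₂ : g₂ * x < f₂ * y) :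
    x ^ 2 / (f₁ * f₂) < y ^ 2 / (g₁ * g₂) := by
  rw [div_lt_div_iff₀ (by positivity) (by positivity)]
  calc x ^ 2 * (g₁ * g₂) = (g₁ * x) * (g₂ * x) := by ring
    _ < (f₁ * y) * (f₂ * y) := mul_lt_mul'' h₁ h₂ (by positivity) (by positivity)
    _ = y ^ 2 * (f₁ * f₂) := by ring

/-- The difference of the two sides factors as `(y - x) (V - x y a² c)`, and `c ≤ V` with `0 ≤ x y
a² ≤ 1` makes the second factor nonnegative. -/
lemma wgCosTilt_mul_le {m : ℕ} {q : ℝ} (hm : 3 ≤ m) (hq : 0 < q) {x y a : ℝ} (hx : 0 < x)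
    (hxy : x < y) (hy : y ≤ 1) (ha : |a| < 1) :
    wgCosTilt m q (y * a) * x ≤ wgCosTilt m q (x * a) * y := by
  have hV : 0 < wgCosTilt m q 0 := wgCosTilt_pos hm hq (by simp)
  have h := wgMoment_mul_sub_sq_le hm hq
  simp only [wgCosTilt] at hV ⊢
  have ha2 : a ^ 2 ≤ 1 := (sq_le_one_iff_abs_le_one a).2 ha.le
  have hk : x * y * a ^ 2 ≤ 1 :=
    mul_le_one₀ (mul_le_one₀ (by linarith) (by linarith) hy) (sq_nonneg a) ha2
  have hk0 : 0 ≤ x * y * a ^ 2 := mul_nonneg (by nlinarith) (sq_nonneg a)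
  set V := wgMoment m q 2 - wgMoment m q 1 ^ 2
  set c := wgMoment m q 1 * wgMoment m q 3 - wgMoment m q 2 ^ 2
  have hV' : 0 < V := by simpa [V] using hV
  have hc : x * y * a ^ 2 * c ≤ V := by nlinarith
  have := mul_nonneg (sub_nonneg.2 hc) (sub_pos.2 hxy).le
  simp only [V, c] at this
  nlinarith

/-- The tilt is affine, so its slope cancels and the difference is `(y - x)` times the value at `0`.
-/
lemma wgSinTilt_mul_lt {m : ℕ} {q : ℝ} (hm : 3 ≤ m) (hq : 0 < q) {x y a : ℝ} (hxy : x < y) :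
    wgSinTilt m q (y * a) * x < wgSinTilt m q (x * a) * y := by
  have hS : 0 < wgSinTilt m q 0 := wgSinTilt_pos hm hq (by simp)
  simp only [wgSinTilt] at hS ⊢
  nlinarith

lemma abs_mul_lt_one_of_abs_le_one {x a : ℝ} (hx : |x| ≤ 1) (ha : |a| < 1) : |x * a| < 1 := by
  rw [abs_mul]
  nlinarith [abs_nonneg x, abs_nonneg a]

lemma strictMonoOn_bwgCorr {m₁ m₂ : ℕ} {q s : ℝ} (hm₁ : 3 ≤ m₁) (hm₂ : 3 ≤ m₂) (hq : 0 < q)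
    (hs : 0 < s) {a b : ℝ} (ha : |a| < 1) (hb : |b| < 1) :
    StrictMonoOn (bwgCorr m₁ m₂ q s a b) (Set.Ioc 0 1) := by
  rintro x ⟨hx, hx1⟩ y ⟨hy, hy1⟩ hxy
  have hx' : |x| ≤ 1 := by rwa [abs_of_pos hx]
  have hy' : |y| ≤ 1 := by rwa [abs_of_pos hy]
  have h {z c : ℝ} (hz : |z| ≤ 1) (hc : |c| < 1) := abs_mul_lt_one_of_abs_le_one hz hc
  have hS := mul_pos (wgSinTilt_pos hm₁ hq (t := 0) (by simp))
    (wgSinTilt_pos hm₂ hs (t := 0) (by simp))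
  -- The cosine term is only shown to be monotone; strictness comes from the sine term.
  refine add_lt_add_of_le_of_lt (mul_le_mul_of_nonneg_left ?_ (sq_nonneg _))
    (mul_lt_mul_of_pos_left ?_ (pow_pos hS 2))
  · exact sq_div_mul_le_sq_div_mul hx (wgCosTilt_pos hm₁ hq (h hx' hb))
      (wgCosTilt_pos hm₁ hq (h hy' hb)) (wgCosTilt_pos hm₂ hs (h hx' ha))
      (wgCosTilt_pos hm₂ hs (h hy' ha)) (wgCosTilt_mul_le hm₁ hq hx hxy hy1 hb)
      (wgCosTilt_mul_le hm₂ hs hx hxy hy1 ha)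
  · exact sq_div_mul_lt_sq_div_mul hx (wgSinTilt_pos hm₁ hq (h hx' hb))
      (wgSinTilt_pos hm₁ hq (h hy' hb)) (wgSinTilt_pos hm₂ hs (h hx' ha))
      (wgSinTilt_pos hm₂ hs (h hy' ha)) (wgSinTilt_mul_lt hm₁ hq hxy)
      (wgSinTilt_mul_lt hm₂ hs hxy)

lemma bwgCorr_neg (m₁ m₂ : ℕ) (q s a b ρ : ℝ) :
    bwgCorr m₁ m₂ q s (-a) (-b) (-ρ) = bwgCorr m₁ m₂ q s a b ρ := by
  simp [bwgCorr]

lemma strictAntiOn_bwgCorr {m₁ m₂ : ℕ} {q s : ℝ} (hm₁ : 3 ≤ m₁) (hm₂ : 3 ≤ m₂) (hq : 0 < q)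
    (hs : 0 < s) {a b : ℝ} (ha : |a| < 1) (hb : |b| < 1) :
    StrictAntiOn (bwgCorr m₁ m₂ q s a b) (Set.Ico (-1) 0) := by
  rintro x ⟨hx, hx0⟩ y ⟨hy, hy0⟩ hxy
  rw [← bwgCorr_neg _ _ _ _ _ _ x, ← bwgCorr_neg _ _ _ _ _ _ y]
  exact strictMonoOn_bwgCorr hm₁ hm₂ hq hs (by rwa [abs_neg]) (by rwa [abs_neg])
    ⟨by linarith, by linarith⟩ ⟨by linarith, by linarith⟩ (neg_lt_neg hxy)

end Monotonicity

/-! ### Invariance under rotation of the embedded angles. -/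

section Rotation

/-- The matrix of the rotation by the angle `a`. -/
noncomputable def planeRotation (a : ℝ) : Matrix (Fin 2) (Fin 2) ℝ :=
  !![Real.cos a, -Real.sin a; Real.sin a, Real.cos a]

lemma planeRotation_mul_transpose (a : ℝ) :
    planeRotation a * (planeRotation a).transpose = 1 := by
  have h := Real.sin_sq_add_cos_sq a
  ext i j
  fin_cases i <;> fin_cases j <;>
    simp [planeRotation, Matrix.mul_apply, Fin.sum_univ_two] <;> linarith

lemma planeRotation_transpose_mul (a : ℝ) :
    (planeRotation a).transpose * planeRotation a = 1 :=
  mul_eq_one_comm.1 (planeRotation_mul_transpose a)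

lemma circleEmbed_add (x a : ℝ) :
    circleEmbed (x + a) = (planeRotation a).mulVec (circleEmbed x) := by
  ext i
  fin_cases i <;>
    simp [circleEmbed, planeRotation, Matrix.mulVec, dotProduct, Fin.sum_univ_two, Real.cos_add,
      Real.sin_add] <;> ring

variable {μ : Measure (ℝ × ℝ)} {X Y : ℝ × ℝ → ℝ}

lemma memLp_circleEmbed [IsFiniteMeasure μ] (hX : Measurable X) (i : Fin 2) :
    MemLp (fun ω => circleEmbed (X ω) i) 2 μ := by
  refine MemLp.of_bound (C := 1) ?_ (ae_of_all _ fun ω => ?_)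
  · apply Measurable.aestronglyMeasurable
    fin_cases i
    · exact Real.measurable_cos.comp hX
    · exact Real.measurable_sin.comp hX
  · fin_cases i
    · exact Real.abs_cos_le_one _
    · exact Real.abs_sin_le_one _

lemma angleCov_add_const [IsFiniteMeasure μ] (hX : Measurable X) (hY : Measurable Y) (a b : ℝ) :
    angleCov μ (fun ω => X ω + a) (fun ω => Y ω + b) =
      planeRotation a * angleCov μ X Y * (planeRotation b).transpose := by
  ext i j
  simp only [angleCov, Matrix.of_apply, circleEmbed_add, Matrix.mulVec, dotProduct,
    Matrix.mul_apply, Matrix.transpose_apply]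
  rw [covariance_fun_sum_fun_sum (fun k => (memLp_circleEmbed hX k).const_mul _)
    (fun k => (memLp_circleEmbed hY k).const_mul _), Finset.sum_comm]
  simp only [covariance_const_mul_left, covariance_const_mul_right, Finset.sum_mul]
  exact Finset.sum_congr rfl fun _ _ => Finset.sum_congr rfl fun _ _ => by ring

lemma det_angleCov_add_const [IsFiniteMeasure μ] (hX : Measurable X) (a : ℝ) :
    (angleCov μ (fun ω => X ω + a) (fun ω => X ω + a)).det = (angleCov μ X X).det := by
  rw [angleCov_add_const hX hX, Matrix.det_mul_right_comm, planeRotation_mul_transpose, one_mul]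

lemma rotation_conj_inv {R D : Matrix (Fin 2) (Fin 2) ℝ} (h : R * R.transpose = 1) :
    (R * D * R.transpose)⁻¹ = R * D⁻¹ * R.transpose := by
  have h1 : R⁻¹ = R.transpose := Matrix.inv_eq_right_inv h
  have h2 : R.transpose⁻¹ = R := Matrix.inv_eq_left_inv h
  rw [Matrix.mul_inv_rev, Matrix.mul_inv_rev, h1, h2, mul_assoc]

/-- Each covariance block is conjugated by orthogonal matrices; the inner ones cancel in the product
and the outer pair cancels by cyclicity of the trace. -/
lemma juppMardia_eq_of_shift [IsFiniteMeasure μ] (a b : ℝ) :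
    juppMardia μ = Matrix.trace
      ((angleCov μ (fun ω => ω.1 - a) (fun ω => ω.1 - a))⁻¹ *
        angleCov μ (fun ω => ω.1 - a) (fun ω => ω.2 - b) *
        (angleCov μ (fun ω => ω.2 - b) (fun ω => ω.2 - b))⁻¹ *
        angleCov μ (fun ω => ω.2 - b) (fun ω => ω.1 - a)) := by
  have h1 : Measurable fun ω : ℝ × ℝ => ω.1 - a := by fun_prop
  have h2 : Measurable fun ω : ℝ × ℝ => ω.2 - b := by fun_prop
  have e1 : (Prod.fst : ℝ × ℝ → ℝ) = fun ω => (ω.1 - a) + a := by ext; simp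
  have e2 : (Prod.snd : ℝ × ℝ → ℝ) = fun ω => (ω.2 - b) + b := by ext; simp
  rw [juppMardia, e1, e2, angleCov_add_const h1 h1, angleCov_add_const h1 h2,
    angleCov_add_const h2 h2, angleCov_add_const h2 h1,
    rotation_conj_inv (planeRotation_mul_transpose a),
    rotation_conj_inv (planeRotation_mul_transpose b)]
  simp only [mul_assoc]
  rw [← mul_assoc (planeRotation a).transpose (planeRotation a),
    ← mul_assoc (planeRotation b).transpose (planeRotation b),
    ← mul_assoc (planeRotation b).transpose (planeRotation b),
    planeRotation_transpose_mul, planeRotation_transpose_mul, one_mul, one_mul, one_mul,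
    Matrix.trace_mul_comm]
  simp only [mul_assoc]
  rw [planeRotation_transpose_mul, mul_one]
  simp only [add_sub_cancel_right]

end Rotation

/-! ### Splitting sums over the bivariate law into one-dimensional means. -/

section Law

variable {m₁ m₂ : ℕ} {α : Fin m₁} {β : Fin m₂} {q s δ ρ : ℝ}

lemma cos_sub_sign_mul (hδ : δ = 1 ∨ δ = -1) (x y : ℝ) :
    Real.cos (x - δ * y) = Real.cos x * Real.cos y + δ * (Real.sin x * Real.sin y) := by
  rcases hδ with rfl | rfl
  · rw [one_mul, Real.cos_sub, one_mul]
  · rw [neg_one_mul, sub_neg_eq_add, Real.cos_add]; ring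

lemma bwgWeight_nonneg (hq : 0 < q) (hs : 0 < s) (hρ : |ρ| ≤ 1) (k : Fin m₁) (l : Fin m₂) :
    0 ≤ bwgWeight α β q s δ ρ k l := by
  refine mul_nonneg (by positivity) ?_
  set x := Real.cos _
  have : |ρ * x| ≤ 1 := by
    rw [abs_mul]
    exact mul_le_one₀ hρ (abs_nonneg _) (Real.abs_cos_le_one _)
  linarith [(abs_le.1 this).1]

/-- Reducing `k - α` modulo `m` changes the angle by `0` or `2π`. -/
lemma periodic_grid_sub {m : ℕ} (α k : Fin m) {F : ℝ → ℝ} (hF : F.Periodic (2 * Real.pi)) :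
    F (2 * Real.pi * ((k : ℕ) : ℝ) / m - 2 * Real.pi * ((α : ℕ) : ℝ) / m) =
      F (2 * Real.pi * (bwgResidue α k : ℝ) / m) := by
  have hm : (m : ℝ) ≠ 0 := by exact_mod_cast (Fin.pos k).ne'
  rw [bwgResidue]
  rcases le_or_gt α k with h | h
  · rw [Fin.coe_sub_iff_le.2 h, Nat.cast_sub h]
    congr 1; ring
  · rw [Fin.coe_sub_iff_lt.2 h, Nat.cast_sub (by omega), Nat.cast_add]
    rw [← hF]
    congr 1; field_simp; ring

/-- A sum against the unnormalised masses splits into products of one-dimensional means. -/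
lemma sum_bwgWeight_mul (hm₁ : 3 ≤ m₁) (hm₂ : 3 ≤ m₂) (hq : 0 < q) (hs : 0 < s)
    (hδ : δ = 1 ∨ δ = -1) {F G : ℝ → ℝ} (hF : F.Periodic (2 * Real.pi))
    (hG : G.Periodic (2 * Real.pi)) :
    ∑ k : Fin m₁, ∑ l : Fin m₂, bwgWeight α β q s δ ρ k l *
      (F (2 * Real.pi * ((k : ℕ) : ℝ) / m₁ - 2 * Real.pi * ((α : ℕ) : ℝ) / m₁) *
        G (2 * Real.pi * ((l : ℕ) : ℝ) / m₂ - 2 * Real.pi * ((β : ℕ) : ℝ) / m₂)) =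
    (∑ i : Fin m₁, (q ^ (i : ℕ) + q ^ (m₁ - (i : ℕ)))) *
      (∑ j : Fin m₂, (s ^ (j : ℕ) + s ^ (m₂ - (j : ℕ)))) *
      (wgMean m₁ q F * wgMean m₂ s G +
        ρ * (wgMean m₁ q (fun x => F x * Real.cos x) * wgMean m₂ s (fun x => G x * Real.cos x) +
        δ * (wgMean m₁ q (fun x => F x * Real.sin x) *
          wgMean m₂ s (fun x => G x * Real.sin x)))) := by
  have : NeZero m₁ := ⟨by omega⟩
  have : NeZero m₂ := ⟨by omega⟩
  have h1 := (wgTotal_pos hm₁ hq).ne'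
  have h2 := (wgTotal_pos hm₂ hs).ne'
  simp only [periodic_grid_sub _ _ hF, periodic_grid_sub _ _ hG, bwgWeight, cos_sub_sign_mul hδ]
  have reindex (H : Fin m₁ → Fin m₂ → ℝ) :
      ∑ k, ∑ l, H (k - α) (l - β) = ∑ k, ∑ l, H k l :=
    ((Equiv.subRight α).sum_comp fun k => ∑ l, H k (l - β)).trans
      (Finset.sum_congr rfl fun k _ => (Equiv.subRight β).sum_comp (H k))
  have clear (z w a b c d e f : ℝ) (hz : z ≠ 0) (hw : w ≠ 0) :
      z * w * (a / z * (b / w) + ρ * (c / z * (d / w) + δ * (e / z * (f / w)))) =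
        a * b + ρ * (c * d + δ * (e * f)) := by
    field_simp
  simp only [bwgResidue, wgMean]
  rw [clear _ _ _ _ _ _ _ _ h1 h2, Finset.sum_mul_sum, Finset.sum_mul_sum, Finset.sum_mul_sum]
  simp only [Finset.mul_sum, ← Finset.sum_add_distrib]
  refine Eq.trans ?_ (reindex _)
  exact Finset.sum_congr rfl fun _ _ => Finset.sum_congr rfl fun _ _ => by ring

end Law

/-! ### The means that occur in the covariances. -/

section Means

variable {m : ℕ} {q : ℝ}

lemma wgMean_one (hm : 3 ≤ m) (hq : 0 < q) : wgMean m q (fun _ => 1) = 1 := by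
  rw [wgMean_cubic hm hq 1 0 0 0 fun x => by ring]; ring

lemma wgMean_cos (hm : 3 ≤ m) (hq : 0 < q) : wgMean m q Real.cos = wgMoment m q 1 := by
  rw [wgMean_cubic hm hq 0 1 0 0 fun x => by ring]; ring

lemma wgMean_cos_mul_cos (hm : 3 ≤ m) (hq : 0 < q) :
    wgMean m q (fun x => Real.cos x * Real.cos x) = wgMoment m q 2 := by
  rw [wgMean_cubic hm hq 0 0 1 0 fun x => by ring]; ring

lemma wgMean_cos_mul_cos_mul_cos (hm : 3 ≤ m) (hq : 0 < q) :
    wgMean m q (fun x => Real.cos x * Real.cos x * Real.cos x) = wgMoment m q 3 := by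
  rw [wgMean_cubic hm hq 0 0 0 1 fun x => by ring]; ring

lemma wgMean_sin_mul_sin (hm : 3 ≤ m) (hq : 0 < q) :
    wgMean m q (fun x => Real.sin x * Real.sin x) = 1 - wgMoment m q 2 := by
  rw [wgMean_cubic hm hq 1 0 (-1) 0 fun x => by rw [← sq, Real.sin_sq]; ring]; ring

lemma wgMean_sin_mul_sin_mul_cos (hm : 3 ≤ m) (hq : 0 < q) :
    wgMean m q (fun x => Real.sin x * Real.sin x * Real.cos x) =
      wgMoment m q 1 - wgMoment m q 3 := by
  rw [wgMean_cubic hm hq 0 1 0 (-1) fun x => by rw [← sq, Real.sin_sq]; ring]; ring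

lemma wgMean_sin (hm : 3 ≤ m) : wgMean m q Real.sin = 0 :=
  wgMean_eq_zero_of_odd hm Real.sin_periodic Real.sin_neg

lemma wgMean_cos_mul_sin (hm : 3 ≤ m) :
    wgMean m q (fun x => Real.cos x * Real.sin x) = 0 :=
  wgMean_eq_zero_of_odd hm (fun x => by simp) (fun x => by simp)

lemma wgMean_sin_mul_cos (hm : 3 ≤ m) :
    wgMean m q (fun x => Real.sin x * Real.cos x) = 0 :=
  wgMean_eq_zero_of_odd hm (fun x => by simp) (fun x => by simp)

lemma wgMean_cos_mul_sin_mul_cos (hm : 3 ≤ m) :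
    wgMean m q (fun x => Real.cos x * Real.sin x * Real.cos x) = 0 :=
  wgMean_eq_zero_of_odd hm (fun x => by simp) (fun x => by simp)

end Means

/-! ### Normalisation, covariance matrices and the closed form of the coefficient. -/

section Law

variable {m₁ m₂ : ℕ} {α : Fin m₁} {β : Fin m₂} {q s δ ρ : ℝ}

/-- Strictness keeps the normaliser and the marginal tilts positive even at `ρ = ±1`, where the
joint weight may vanish at some points. -/
lemma abs_wgMoment_one_lt_one {m : ℕ} (hm : 3 ≤ m) (hq : 0 < q) : |wgMoment m q 1| < 1 :=
  abs_lt.2 ⟨neg_one_lt_wgMoment_one hm hq, wgMoment_one_lt_one hm hq⟩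

lemma bwgNormalizer_pos (hm₁ : 3 ≤ m₁) (hm₂ : 3 ≤ m₂) (hq : 0 < q) (hs : 0 < s)
    (hρ : |ρ| ≤ 1) : 0 < 1 + ρ * (wgMoment m₁ q 1 * wgMoment m₂ s 1) := by
  have h := abs_mul_lt_one_of_abs_le_one
    (abs_mul_lt_one_of_abs_le_one hρ (abs_wgMoment_one_lt_one hm₁ hq)).le
    (abs_wgMoment_one_lt_one hm₂ hs)
  rw [mul_assoc] at h
  linarith [(abs_lt.1 h).1]

lemma sum_bwgWeight (hm₁ : 3 ≤ m₁) (hm₂ : 3 ≤ m₂) (hq : 0 < q) (hs : 0 < s)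
    (hδ : δ = 1 ∨ δ = -1) :
    ∑ k : Fin m₁, ∑ l : Fin m₂, bwgWeight α β q s δ ρ k l =
    (∑ i : Fin m₁, (q ^ (i : ℕ) + q ^ (m₁ - (i : ℕ)))) *
      (∑ j : Fin m₂, (s ^ (j : ℕ) + s ^ (m₂ - (j : ℕ)))) *
      (1 + ρ * (wgMoment m₁ q 1 * wgMoment m₂ s 1)) := by
  have h := sum_bwgWeight_mul (α := α) (β := β) (ρ := ρ) hm₁ hm₂ hq hs hδ (F := fun _ => 1)
    (G := fun _ => 1) (fun _ => rfl) (fun _ => rfl)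
  simpa only [one_mul, mul_one, wgMean_one hm₁ hq, wgMean_one hm₂ hs, wgMean_cos hm₁ hq,
    wgMean_cos hm₂ hs, wgMean_sin hm₁, zero_mul, mul_zero, add_zero] using h

lemma bwgPmf_nonneg (hq : 0 < q) (hs : 0 < s) (hρ : |ρ| ≤ 1) (k : Fin m₁) (l : Fin m₂) :
    0 ≤ bwgPmf α β q s δ ρ k l :=
  div_nonneg (bwgWeight_nonneg hq hs hρ k l) <| Finset.sum_nonneg fun _ _ =>
    Finset.sum_nonneg fun _ _ => bwgWeight_nonneg hq hs hρ _ _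

lemma isProbabilityMeasure_bwg (hm₁ : 3 ≤ m₁) (hm₂ : 3 ≤ m₂) (hq : 0 < q) (hs : 0 < s)
    (hδ : δ = 1 ∨ δ = -1) (hρ : |ρ| ≤ 1) : IsProbabilityMeasure (bwg α β q s δ ρ) := by
  have hZ : ∑ k : Fin m₁, ∑ l : Fin m₂, bwgWeight α β q s δ ρ k l ≠ 0 := by
    rw [sum_bwgWeight hm₁ hm₂ hq hs hδ]
    exact (mul_pos (mul_pos (wgTotal_pos hm₁ hq) (wgTotal_pos hm₂ hs))
      (bwgNormalizer_pos hm₁ hm₂ hq hs hρ)).ne'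
  constructor
  have h0 := bwgPmf_nonneg (α := α) (β := β) (δ := δ) hq hs hρ
  simp only [bwg, Measure.finsetSum_apply, Measure.smul_apply, measure_univ, smul_eq_mul, mul_one]
  simp only [← ENNReal.ofReal_sum_of_nonneg fun l _ => h0 _ l]
  rw [← ENNReal.ofReal_sum_of_nonneg fun k _ => Finset.sum_nonneg fun l _ => h0 k l]
  simp only [bwgPmf, ← Finset.sum_div]
  rw [div_self hZ, ENNReal.ofReal_one]

lemma integral_bwg (hq : 0 < q) (hs : 0 < s) (hρ : |ρ| ≤ 1) (f : ℝ × ℝ → ℝ) :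
    ∫ ω, f ω ∂(bwg α β q s δ ρ) = ∑ k : Fin m₁, ∑ l : Fin m₂, bwgPmf α β q s δ ρ k l *
      f (2 * Real.pi * ((k : ℕ) : ℝ) / m₁, 2 * Real.pi * ((l : ℕ) : ℝ) / m₂) := by
  have hint (k : Fin m₁) (l : Fin m₂) : Integrable f (ENNReal.ofReal (bwgPmf α β q s δ ρ k l) •
      Measure.dirac (2 * Real.pi * ((k : ℕ) : ℝ) / (m₁ : ℝ),
        2 * Real.pi * ((l : ℕ) : ℝ) / (m₂ : ℝ))) :=
    (integrable_dirac (by simp)).smul_measure ENNReal.ofReal_ne_top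
  rw [bwg, integral_finsetSum_measure fun k _ => integrable_finsetSum_measure.2 fun l _ => hint k l]
  refine Finset.sum_congr rfl fun k _ => ?_
  rw [integral_finsetSum_measure fun l _ => hint k l]
  refine Finset.sum_congr rfl fun l _ => ?_
  rw [integral_smul_measure, integral_dirac, smul_eq_mul,
    ENNReal.toReal_ofReal (bwgPmf_nonneg hq hs hρ k l)]

/-- Mixed moments of the angles, recentred at the modes, in terms of one-dimensional means. -/
lemma integral_bwg_mul (hm₁ : 3 ≤ m₁) (hm₂ : 3 ≤ m₂) (hq : 0 < q) (hs : 0 < s)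
    (hδ : δ = 1 ∨ δ = -1) (hρ : |ρ| ≤ 1) {F G : ℝ → ℝ} (hF : F.Periodic (2 * Real.pi))
    (hG : G.Periodic (2 * Real.pi)) :
    ∫ ω, F (ω.1 - 2 * Real.pi * ((α : ℕ) : ℝ) / m₁) * G (ω.2 - 2 * Real.pi * ((β : ℕ) : ℝ) / m₂)
      ∂(bwg α β q s δ ρ) =
    (wgMean m₁ q F * wgMean m₂ s G +
        ρ * (wgMean m₁ q (fun x => F x * Real.cos x) * wgMean m₂ s (fun x => G x * Real.cos x) +
        δ * (wgMean m₁ q (fun x => F x * Real.sin x) *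
          wgMean m₂ s (fun x => G x * Real.sin x)))) /
      (1 + ρ * (wgMoment m₁ q 1 * wgMoment m₂ s 1)) := by
  rw [integral_bwg hq hs hρ]
  simp only [bwgPmf, div_mul_eq_mul_div, ← Finset.sum_div]
  rw [sum_bwgWeight_mul hm₁ hm₂ hq hs hδ hF hG, sum_bwgWeight hm₁ hm₂ hq hs hδ,
    mul_div_mul_left _ _ (mul_pos (wgTotal_pos hm₁ hq) (wgTotal_pos hm₂ hs)).ne']

lemma integral_bwg_fst (hm₁ : 3 ≤ m₁) (hm₂ : 3 ≤ m₂) (hq : 0 < q) (hs : 0 < s)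
    (hδ : δ = 1 ∨ δ = -1) (hρ : |ρ| ≤ 1) {F : ℝ → ℝ} (hF : F.Periodic (2 * Real.pi)) :
    ∫ ω, F (ω.1 - 2 * Real.pi * ((α : ℕ) : ℝ) / m₁) ∂(bwg α β q s δ ρ) =
    (wgMean m₁ q F + ρ * (wgMean m₁ q (fun x => F x * Real.cos x) * wgMoment m₂ s 1)) /
      (1 + ρ * (wgMoment m₁ q 1 * wgMoment m₂ s 1)) := by
  have h := integral_bwg_mul (α := α) (β := β) hm₁ hm₂ hq hs hδ hρ hF (G := fun _ => 1)
    (fun _ => rfl)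
  simpa only [one_mul, mul_one, wgMean_one hm₂ hs, wgMean_cos hm₂ hs, wgMean_sin hm₂, mul_zero,
    add_zero] using h

lemma integral_bwg_snd (hm₁ : 3 ≤ m₁) (hm₂ : 3 ≤ m₂) (hq : 0 < q) (hs : 0 < s)
    (hδ : δ = 1 ∨ δ = -1) (hρ : |ρ| ≤ 1) {G : ℝ → ℝ} (hG : G.Periodic (2 * Real.pi)) :
    ∫ ω, G (ω.2 - 2 * Real.pi * ((β : ℕ) : ℝ) / m₂) ∂(bwg α β q s δ ρ) =
    (wgMean m₂ s G + ρ * (wgMoment m₁ q 1 * wgMean m₂ s (fun x => G x * Real.cos x))) /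
      (1 + ρ * (wgMoment m₁ q 1 * wgMoment m₂ s 1)) := by
  have h := integral_bwg_mul (α := α) (β := β) hm₁ hm₂ hq hs hδ hρ (F := fun _ => 1)
    (fun _ => rfl) hG
  simpa only [one_mul, wgMean_one hm₁ hq, wgMean_cos hm₁ hq, wgMean_sin hm₁, mul_zero,
    zero_mul, add_zero] using h

lemma angleCov_eq_integrals {μ : Measure (ℝ × ℝ)} [IsProbabilityMeasure μ] {X Y : ℝ × ℝ → ℝ}
    (hX : Measurable X) (hY : Measurable Y) :
    angleCov μ X Y =
      !![∫ ω, Real.cos (X ω) * Real.cos (Y ω) ∂μ -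
          (∫ ω, Real.cos (X ω) ∂μ) * ∫ ω, Real.cos (Y ω) ∂μ,
        ∫ ω, Real.cos (X ω) * Real.sin (Y ω) ∂μ -
          (∫ ω, Real.cos (X ω) ∂μ) * ∫ ω, Real.sin (Y ω) ∂μ;
        ∫ ω, Real.sin (X ω) * Real.cos (Y ω) ∂μ -
          (∫ ω, Real.sin (X ω) ∂μ) * ∫ ω, Real.cos (Y ω) ∂μ,
        ∫ ω, Real.sin (X ω) * Real.sin (Y ω) ∂μ -
          (∫ ω, Real.sin (X ω) ∂μ) * ∫ ω, Real.sin (Y ω) ∂μ] := by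
  ext i j
  rw [angleCov, Matrix.of_apply,
    covariance_eq_sub (memLp_circleEmbed hX i) (memLp_circleEmbed hY j)]
  fin_cases i <;> fin_cases j <;> simp [circleEmbed]

lemma angleCov_transpose (μ : Measure (ℝ × ℝ)) (X Y : ℝ × ℝ → ℝ) :
    (angleCov μ X Y).transpose = angleCov μ Y X := by
  ext i j
  exact covariance_comm _ _

lemma matrix_fin_two_congr {a b c d a' b' c' d' : ℝ} (ha : a = a') (hb : b = b') (hc : c = c')
    (hd : d = d') : !![a, b; c, d] = !![a', b'; c', d'] := by
  rw [ha, hb, hc, hd]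

lemma cos_mul_cos_periodic : (fun x => Real.cos x * Real.cos x).Periodic (2 * Real.pi) :=
  fun x => by simp

lemma cos_mul_sin_periodic : (fun x => Real.cos x * Real.sin x).Periodic (2 * Real.pi) :=
  fun x => by simp

lemma sin_mul_sin_periodic : (fun x => Real.sin x * Real.sin x).Periodic (2 * Real.pi) :=
  fun x => by simp

variable (α β)

/-- Summing out the second angle leaves the weight tilted by `1 + t cos`, with `t = ρ * wgMoment m₂
s 1`. The sine has mean zero, hence only one power of the normaliser in its entry. -/
lemma angleCov_bwg_fst (hm₁ : 3 ≤ m₁) (hm₂ : 3 ≤ m₂) (hq : 0 < q) (hs : 0 < s)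
    (hδ : δ = 1 ∨ δ = -1) (hρ : |ρ| ≤ 1) :
    angleCov (bwg α β q s δ ρ) (fun ω => ω.1 - 2 * Real.pi * ((α : ℕ) : ℝ) / m₁)
      (fun ω => ω.1 - 2 * Real.pi * ((α : ℕ) : ℝ) / m₁) =
    !![wgCosTilt m₁ q (ρ * wgMoment m₂ s 1) /
        (1 + ρ * (wgMoment m₁ q 1 * wgMoment m₂ s 1)) ^ 2, 0;
      0, wgSinTilt m₁ q (ρ * wgMoment m₂ s 1) /
        (1 + ρ * (wgMoment m₁ q 1 * wgMoment m₂ s 1))] := by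
  have := isProbabilityMeasure_bwg (α := α) (β := β) hm₁ hm₂ hq hs hδ hρ
  have hN := (bwgNormalizer_pos hm₁ hm₂ hq hs hρ).ne'
  rw [angleCov_eq_integrals (by fun_prop) (by fun_prop)]
  simp only [mul_comm (Real.sin _) (Real.cos _),
    integral_bwg_fst hm₁ hm₂ hq hs hδ hρ Real.cos_periodic,
    integral_bwg_fst hm₁ hm₂ hq hs hδ hρ Real.sin_periodic,
    integral_bwg_fst hm₁ hm₂ hq hs hδ hρ cos_mul_cos_periodic,
    integral_bwg_fst hm₁ hm₂ hq hs hδ hρ cos_mul_sin_periodic,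
    integral_bwg_fst hm₁ hm₂ hq hs hδ hρ sin_mul_sin_periodic]
  simp only [wgMean_cos hm₁ hq, wgMean_cos_mul_cos hm₁ hq, wgMean_cos_mul_cos_mul_cos hm₁ hq,
    wgMean_sin_mul_sin hm₁ hq, wgMean_sin_mul_sin_mul_cos hm₁ hq, wgMean_sin hm₁,
    wgMean_cos_mul_sin hm₁, wgMean_cos_mul_sin_mul_cos hm₁, wgCosTilt, wgSinTilt]
  apply matrix_fin_two_congr
  · field_simp
  · simp
  · simp
  · ring

lemma angleCov_bwg_snd (hm₁ : 3 ≤ m₁) (hm₂ : 3 ≤ m₂) (hq : 0 < q) (hs : 0 < s)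
    (hδ : δ = 1 ∨ δ = -1) (hρ : |ρ| ≤ 1) :
    angleCov (bwg α β q s δ ρ) (fun ω => ω.2 - 2 * Real.pi * ((β : ℕ) : ℝ) / m₂)
      (fun ω => ω.2 - 2 * Real.pi * ((β : ℕ) : ℝ) / m₂) =
    !![wgCosTilt m₂ s (ρ * wgMoment m₁ q 1) /
        (1 + ρ * (wgMoment m₁ q 1 * wgMoment m₂ s 1)) ^ 2, 0;
      0, wgSinTilt m₂ s (ρ * wgMoment m₁ q 1) /
        (1 + ρ * (wgMoment m₁ q 1 * wgMoment m₂ s 1))] := by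
  have := isProbabilityMeasure_bwg (α := α) (β := β) hm₁ hm₂ hq hs hδ hρ
  have hN := (bwgNormalizer_pos hm₁ hm₂ hq hs hρ).ne'
  rw [angleCov_eq_integrals (by fun_prop) (by fun_prop)]
  simp only [mul_comm (Real.sin _) (Real.cos _),
    integral_bwg_snd hm₁ hm₂ hq hs hδ hρ Real.cos_periodic,
    integral_bwg_snd hm₁ hm₂ hq hs hδ hρ Real.sin_periodic,
    integral_bwg_snd hm₁ hm₂ hq hs hδ hρ cos_mul_cos_periodic,
    integral_bwg_snd hm₁ hm₂ hq hs hδ hρ cos_mul_sin_periodic,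
    integral_bwg_snd hm₁ hm₂ hq hs hδ hρ sin_mul_sin_periodic]
  simp only [wgMean_cos hm₂ hs, wgMean_cos_mul_cos hm₂ hs, wgMean_cos_mul_cos_mul_cos hm₂ hs,
    wgMean_sin_mul_sin hm₂ hs, wgMean_sin_mul_sin_mul_cos hm₂ hs, wgMean_sin hm₂,
    wgMean_cos_mul_sin hm₂, wgMean_cos_mul_sin_mul_cos hm₂, wgCosTilt, wgSinTilt]
  apply matrix_fin_two_congr
  · field_simp
  · simp
  · simp
  · ring

/-- In the cosine entry the `ρ ^ 2` terms cancel and the coefficient of `ρ` factors into the two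
untilted variances. -/
lemma angleCov_bwg_fst_snd (hm₁ : 3 ≤ m₁) (hm₂ : 3 ≤ m₂) (hq : 0 < q) (hs : 0 < s)
    (hδ : δ = 1 ∨ δ = -1) (hρ : |ρ| ≤ 1) :
    angleCov (bwg α β q s δ ρ) (fun ω => ω.1 - 2 * Real.pi * ((α : ℕ) : ℝ) / m₁)
      (fun ω => ω.2 - 2 * Real.pi * ((β : ℕ) : ℝ) / m₂) =
    !![ρ * (wgCosTilt m₁ q 0 * wgCosTilt m₂ s 0) /
        (1 + ρ * (wgMoment m₁ q 1 * wgMoment m₂ s 1)) ^ 2, 0;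
      0, ρ * δ * (wgSinTilt m₁ q 0 * wgSinTilt m₂ s 0) /
        (1 + ρ * (wgMoment m₁ q 1 * wgMoment m₂ s 1))] := by
  have := isProbabilityMeasure_bwg (α := α) (β := β) hm₁ hm₂ hq hs hδ hρ
  have hN := (bwgNormalizer_pos hm₁ hm₂ hq hs hρ).ne'
  rw [angleCov_eq_integrals (by fun_prop) (by fun_prop)]
  simp only [integral_bwg_fst hm₁ hm₂ hq hs hδ hρ Real.cos_periodic,
    integral_bwg_fst hm₁ hm₂ hq hs hδ hρ Real.sin_periodic,
    integral_bwg_snd hm₁ hm₂ hq hs hδ hρ Real.cos_periodic,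
    integral_bwg_snd hm₁ hm₂ hq hs hδ hρ Real.sin_periodic,
    integral_bwg_mul hm₁ hm₂ hq hs hδ hρ Real.cos_periodic Real.cos_periodic,
    integral_bwg_mul hm₁ hm₂ hq hs hδ hρ Real.cos_periodic Real.sin_periodic,
    integral_bwg_mul hm₁ hm₂ hq hs hδ hρ Real.sin_periodic Real.cos_periodic,
    integral_bwg_mul hm₁ hm₂ hq hs hδ hρ Real.sin_periodic Real.sin_periodic]
  simp only [wgMean_cos hm₁ hq, wgMean_cos_mul_cos hm₁ hq, wgMean_sin_mul_sin hm₁ hq,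
    wgMean_sin hm₁, wgMean_cos_mul_sin hm₁, wgMean_sin_mul_cos hm₁, wgMean_cos hm₂ hs,
    wgMean_cos_mul_cos hm₂ hs, wgMean_sin_mul_sin hm₂ hs, wgMean_sin hm₂, wgMean_cos_mul_sin hm₂,
    wgMean_sin_mul_cos hm₂, wgCosTilt, wgSinTilt]
  apply matrix_fin_two_congr
  · field_simp; ring
  · simp
  · simp
  · ring

lemma det_angleCov_sub_const {μ : Measure (ℝ × ℝ)} [IsFiniteMeasure μ] {X : ℝ × ℝ → ℝ}
    (hX : Measurable X) (a : ℝ) :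
    (angleCov μ (fun ω => X ω - a) (fun ω => X ω - a)).det = (angleCov μ X X).det :=
  det_angleCov_add_const hX (-a)

lemma det_angleCov_bwg_fst_pos (hm₁ : 3 ≤ m₁) (hm₂ : 3 ≤ m₂) (hq : 0 < q) (hs : 0 < s)
    (hδ : δ = 1 ∨ δ = -1) (hρ : |ρ| ≤ 1) :
    0 < (angleCov (bwg α β q s δ ρ) Prod.fst Prod.fst).det := by
  have := isProbabilityMeasure_bwg (α := α) (β := β) hm₁ hm₂ hq hs hδ hρ
  have hN := bwgNormalizer_pos hm₁ hm₂ hq hs hρ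
  have ht := abs_mul_lt_one_of_abs_le_one hρ (abs_wgMoment_one_lt_one hm₂ hs)
  rw [← det_angleCov_sub_const measurable_fst (2 * Real.pi * ((α : ℕ) : ℝ) / m₁),
    angleCov_bwg_fst α β hm₁ hm₂ hq hs hδ hρ, Matrix.det_fin_two_of, mul_zero, sub_zero]
  exact mul_pos (div_pos (wgCosTilt_pos hm₁ hq ht) (pow_pos hN 2))
    (div_pos (wgSinTilt_pos hm₁ hq ht) hN)

lemma det_angleCov_bwg_snd_pos (hm₁ : 3 ≤ m₁) (hm₂ : 3 ≤ m₂) (hq : 0 < q) (hs : 0 < s)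
    (hδ : δ = 1 ∨ δ = -1) (hρ : |ρ| ≤ 1) :
    0 < (angleCov (bwg α β q s δ ρ) Prod.snd Prod.snd).det := by
  have := isProbabilityMeasure_bwg (α := α) (β := β) hm₁ hm₂ hq hs hδ hρ
  have hN := bwgNormalizer_pos hm₁ hm₂ hq hs hρ
  have ht := abs_mul_lt_one_of_abs_le_one hρ (abs_wgMoment_one_lt_one hm₁ hq)
  rw [← det_angleCov_sub_const measurable_snd (2 * Real.pi * ((β : ℕ) : ℝ) / m₂),
    angleCov_bwg_snd α β hm₁ hm₂ hq hs hδ hρ, Matrix.det_fin_two_of, mul_zero, sub_zero]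
  exact mul_pos (div_pos (wgCosTilt_pos hm₂ hs ht) (pow_pos hN 2))
    (div_pos (wgSinTilt_pos hm₂ hs ht) hN)

lemma matrix_fin_two_diag_inv {x y : ℝ} (hx : x ≠ 0) (hy : y ≠ 0) :
    (!![x, 0; 0, y])⁻¹ = !![x⁻¹, 0; 0, y⁻¹] := by
  apply Matrix.inv_eq_right_inv
  simp [hx, hy, Matrix.one_fin_two]

lemma juppMardia_bwg (hm₁ : 3 ≤ m₁) (hm₂ : 3 ≤ m₂) (hq : 0 < q) (hs : 0 < s)
    (hδ : δ = 1 ∨ δ = -1) (hρ : |ρ| ≤ 1) :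
    juppMardia (bwg α β q s δ ρ) =
      bwgCorr m₁ m₂ q s (wgMoment m₁ q 1) (wgMoment m₂ s 1) ρ := by
  have := isProbabilityMeasure_bwg (α := α) (β := β) hm₁ hm₂ hq hs hδ hρ
  have hN := (bwgNormalizer_pos hm₁ hm₂ hq hs hρ).ne'
  have ht₁ := abs_mul_lt_one_of_abs_le_one hρ (abs_wgMoment_one_lt_one hm₂ hs)
  have ht₂ := abs_mul_lt_one_of_abs_le_one hρ (abs_wgMoment_one_lt_one hm₁ hq)
  have c₁ := (wgCosTilt_pos hm₁ hq ht₁).ne'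
  have s₁ := (wgSinTilt_pos hm₁ hq ht₁).ne'
  have c₂ := (wgCosTilt_pos hm₂ hs ht₂).ne'
  have s₂ := (wgSinTilt_pos hm₂ hs ht₂).ne'
  have hδ2 : δ ^ 2 = 1 := by rcases hδ with rfl | rfl <;> norm_num
  rw [juppMardia_eq_of_shift (2 * Real.pi * ((α : ℕ) : ℝ) / m₁) (2 * Real.pi * ((β : ℕ) : ℝ) / m₂),
    ← angleCov_transpose _ (fun ω => ω.1 - 2 * Real.pi * ((α : ℕ) : ℝ) / m₁)
      fun ω => ω.2 - 2 * Real.pi * ((β : ℕ) : ℝ) / m₂,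
    angleCov_bwg_fst α β hm₁ hm₂ hq hs hδ hρ, angleCov_bwg_snd α β hm₁ hm₂ hq hs hδ hρ,
    angleCov_bwg_fst_snd α β hm₁ hm₂ hq hs hδ hρ,
    matrix_fin_two_diag_inv (div_ne_zero c₁ (pow_ne_zero 2 hN)) (div_ne_zero s₁ hN),
    matrix_fin_two_diag_inv (div_ne_zero c₂ (pow_ne_zero 2 hN)) (div_ne_zero s₂ hN)]
  simp only [Matrix.mul_fin_two, Matrix.trace_fin_two, Matrix.transpose_apply, Matrix.mul_apply,
    Fin.sum_univ_two, Matrix.of_apply, Matrix.cons_val_zero, Matrix.cons_val_one,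
    Matrix.cons_val_fin_one, mul_zero, zero_mul, add_zero, zero_add, bwgCorr]
  -- All powers of the normaliser cancel, so it can be treated as an arbitrary nonzero number; `δ`
  -- survives only as `δ ^ 2`.
  generalize 1 + ρ * (wgMoment m₁ q 1 * wgMoment m₂ s 1) = N at hN ⊢
  field_simp
  rw [hδ2]
  ring

end Law

theorem theorem5p1 (m₁ m₂ : ℕ) (hm₁ : 3 ≤ m₁) (hm₂ : 3 ≤ m₂) (α : Fin m₁) (β : Fin m₂)
    (q s δ : ℝ) (hq : q ∈ Set.Ioo (0 : ℝ) 1) (hs : s ∈ Set.Ioo (0 : ℝ) 1)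
    (hδ : δ = 1 ∨ δ = -1) :
    (∀ ρ ∈ Set.Icc (-1 : ℝ) 1,
      IsProbabilityMeasure (bwg α β q s δ ρ) ∧
      IsUnit (angleCov (bwg α β q s δ ρ) Prod.fst Prod.fst).det ∧
      IsUnit (angleCov (bwg α β q s δ ρ) Prod.snd Prod.snd).det) ∧
    StrictMonoOn (fun ρ : ℝ => juppMardia (bwg α β q s δ ρ)) (Set.Ioc 0 1) ∧
    StrictAntiOn (fun ρ : ℝ => juppMardia (bwg α β q s δ ρ)) (Set.Ico (-1) 0) := by
  have habs {ρ : ℝ} (h : ρ ∈ Set.Icc (-1 : ℝ) 1) : |ρ| ≤ 1 := abs_le.2 h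
  have h₁ := abs_wgMoment_one_lt_one hm₁ hq.1
  have h₂ := abs_wgMoment_one_lt_one hm₂ hs.1
  refine ⟨fun ρ hρ => ⟨isProbabilityMeasure_bwg hm₁ hm₂ hq.1 hs.1 hδ (habs hρ),
    (det_angleCov_bwg_fst_pos α β hm₁ hm₂ hq.1 hs.1 hδ (habs hρ)).ne'.isUnit,
    (det_angleCov_bwg_snd_pos α β hm₁ hm₂ hq.1 hs.1 hδ (habs hρ)).ne'.isUnit⟩, ?_, ?_⟩
  · exact (strictMonoOn_bwgCorr hm₁ hm₂ hq.1 hs.1 h₁ h₂).congr fun ρ hρ =>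
      (juppMardia_bwg α β hm₁ hm₂ hq.1 hs.1 hδ (habs ⟨by linarith [hρ.1], hρ.2⟩)).symm
  · exact (strictAntiOn_bwgCorr hm₁ hm₂ hq.1 hs.1 h₁ h₂).congr fun ρ hρ =>
      (juppMardia_bwg α β hm₁ hm₂ hq.1 hs.1 hδ (habs ⟨hρ.1, by linarith [hρ.2]⟩)).symm
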